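/- Let $G$ be a locally compact (Hausdorff) group with left Haar measure $\mu$, and let $\omega : G \to (0,\infty)$ be a weight, i.e. a continuous function with $\omega(xy) \le \omega(x)\omega(y)$ for all $x,y \in G$. Let $L^1(G,\omega)$ be the Banach algebra of (classes of) measurable functions $f : G \to \mathbb{C}$ with $\|f\|_\omega = \int_G |f(x)|\,\omega(x)\,d\mu(x) < \infty$, with the convolution product $(f*g)(x) = \int_G f(y)\, g(y^{-1}x)\,d\mu(y)$. Suppose that $\omega$ is bounded away from $0$, i.e. there is $c > 0$ with $\omega(x) \ge c$ for all $x \in G$, and that $A = L^1(G,\omega)$ is pseudo-amenable, i.e. there is a net $(m_i)_i$, not necessarily bounded, in the projective tensor product $A \hat\otimes A$ such that $a\cdot m_i - m_i \cdot a \to 0$ and $a\,\pi(m_i) \to a$ in norm for every $a \in A$. Here $a\cdot(b\otimes c) = ab\otimes c$, $(b\otimes c)\cdot a = b\otimes ca$, and $\pi : A\hat\otimes A \to A$ is the continuous linear map with $\pi(b\otimes c) = bc$. Then $G$ is amenable, i.e. there is a left-invariant mean on $L^\infty(G)$. -/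

import Mathlib

open MeasureTheory Filter Topology
open scoped ENNReal NNReal TensorProduct

universe u

noncomputable section

section ProjectiveTensor

variable (A : Type u) [NonUnitalNormedRing A] [NormedSpace ℂ A] [IsScalarTower ℂ A A]
  [SMulCommClass ℂ A A]

/-- The projective tensor product `A ⊗̂ A`: the completion of the algebraic tensor product
`A ⊗ A` over `ℂ` (as a tensor product indexed by `Fin 2`) for the projective seminorm, which is
the one that Mathlib puts on `⨂[ℂ] _ : Fin 2, A`. -/
abbrev ProjTensor : Type u := UniformSpace.Completion (⨂[ℂ] _ : Fin 2, A)

variable {A}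

/-- The left module action `a · (b ⊗ c) = ab ⊗ c` on `A ⊗̂ A`. -/
def ProjTensor.leftAct (a : A) : ProjTensor A →L[ℂ] ProjTensor A :=
  (PiTensorProduct.mapL (𝕜 := ℂ) (E := fun _ : Fin 2 => A) (E' := fun _ : Fin 2 => A)
    ![ContinuousLinearMap.mul ℂ A a, ContinuousLinearMap.id ℂ A]).completion

/-- The right module action `(b ⊗ c) · a = b ⊗ ca` on `A ⊗̂ A`. -/
def ProjTensor.rightAct (a : A) : ProjTensor A →L[ℂ] ProjTensor A :=
  (PiTensorProduct.mapL (𝕜 := ℂ) (E := fun _ : Fin 2 => A) (E' := fun _ : Fin 2 => A)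
    ![ContinuousLinearMap.id ℂ A, (ContinuousLinearMap.mul ℂ A).flip a]).completion

variable (A) in
/-- Multiplication `(b, c) ↦ bc` as a continuous multilinear map on pairs. -/
def mulMultilinear : ContinuousMultilinearMap ℂ (fun _ : Fin 2 => A) A where
  toFun v := v 0 * v 1
  map_update_add' v i x y := by
    have : ‹DecidableEq (Fin 2)› = instDecidableEqFin 2 := Subsingleton.elim _ _
    subst this
    fin_cases i <;> simp [add_mul, mul_add]
  map_update_smul' v i c x := by
    have : ‹DecidableEq (Fin 2)› = instDecidableEqFin 2 := Subsingleton.elim _ _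
    subst this
    fin_cases i <;> simp [smul_mul_assoc, mul_smul_comm]
  cont := by fun_prop

variable (A) in
/-- The multiplication map `π : A ⊗̂ A → A`, `π (b ⊗ c) = bc`. -/
def ProjTensor.mulMap [CompleteSpace A] : ProjTensor A →L[ℂ] A :=
  (PiTensorProduct.liftIsometry ℂ (fun _ : Fin 2 => A) A (mulMultilinear A)).fromCompletion

theorem ProjTensor.leftAct_tprod (a : A) (v : Fin 2 → A) :
    ProjTensor.leftAct a (PiTensorProduct.tprod ℂ v : ⨂[ℂ] _ : Fin 2, A) =
      (PiTensorProduct.tprod ℂ ![a * v 0, v 1] : ⨂[ℂ] _ : Fin 2, A) := by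
  simp only [leftAct, ContinuousLinearMap.completion_apply_coe, PiTensorProduct.mapL_apply,
    PiTensorProduct.map_tprod]
  congr 2
  ext i
  fin_cases i <;> simp

theorem ProjTensor.rightAct_tprod (a : A) (v : Fin 2 → A) :
    ProjTensor.rightAct a (PiTensorProduct.tprod ℂ v : ⨂[ℂ] _ : Fin 2, A) =
      (PiTensorProduct.tprod ℂ ![v 0, v 1 * a] : ⨂[ℂ] _ : Fin 2, A) := by
  simp only [rightAct, ContinuousLinearMap.completion_apply_coe, PiTensorProduct.mapL_apply,
    PiTensorProduct.map_tprod]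
  congr 2
  ext i
  fin_cases i <;> simp

theorem ProjTensor.mulMap_tprod [CompleteSpace A] (v : Fin 2 → A) :
    ProjTensor.mulMap A (PiTensorProduct.tprod ℂ v : ⨂[ℂ] _ : Fin 2, A) = v 0 * v 1 := by
  simp [mulMap, mulMultilinear]

variable (A) in
/-- A Banach algebra `A` is pseudo-amenable if it has an approximate diagonal: a (not necessarily
bounded) net `(m i)` in `A ⊗̂ A` with `a · m i - m i · a → 0` and `a π(m i) → a` for all `a`. -/
def PseudoAmenable [CompleteSpace A] : Prop :=
  ∃ (ι : Type u) (_ : Preorder ι) (_ : IsDirectedOrder ι) (_ : Nonempty ι) (m : ι → ProjTensor A),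
    ∀ a : A,
      Tendsto (fun i => ProjTensor.leftAct a (m i) - ProjTensor.rightAct a (m i)) atTop (𝓝 0) ∧
      Tendsto (fun i => a * ProjTensor.mulMap A (m i)) atTop (𝓝 a)

end ProjectiveTensor

/-- A weight on `G`: a continuous function `ω : G → (0, ∞)` with `ω (xy) ≤ ω x * ω y`. -/
structure Weight (G : Type u) [Mul G] [TopologicalSpace G] where
  toFun : G → ℝ≥0
  continuous' : Continuous toFun
  pos' : ∀ x, 0 < toFun x
  mul_le' : ∀ x y, toFun (x * y) ≤ toFun x * toFun y

instance (G : Type u) [Mul G] [TopologicalSpace G] : CoeFun (Weight G) (fun _ => G → ℝ≥0) :=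
  ⟨Weight.toFun⟩

section Beurling

variable {G : Type u} [Group G] [TopologicalSpace G] [MeasurableSpace G]

/-- The measure `ω dμ`. -/
def Weight.meas (ω : Weight G) (μ : Measure G) : Measure G := μ.withDensity fun x => (ω x : ℝ≥0∞)

/-- The Beurling space `L¹(G, ω)`: classes of measurable `f : G → ℂ` with
`‖f‖ = ∫ |f x| ω x dμ x < ∞`, where `μ` is a left Haar measure. -/
abbrev BeurlingSpace (μ : Measure G) (ω : Weight G) : Type u := Lp ℂ 1 (ω.meas μ)

variable (μ : Measure G) (ω : Weight G)

variable [IsTopologicalGroup G] [LocallyCompactSpace G] [T2Space G] [BorelSpace G]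
  [μ.IsHaarMeasure] [μ.Regular]

set_option linter.unusedSectionVars false

variable {μ}

theorem Weight.map_meas_le (y : G) :
    (ω.meas μ).map (fun x => y⁻¹ * x) ≤ (ω y : ℝ≥0∞) • ω.meas μ := by
  have hm : Measurable fun x : G => (ω x : ℝ≥0∞) :=
    (ω.continuous'.measurable).coe_nnreal_ennreal
  have hmm : Measurable fun x : G => y⁻¹ * x := (continuous_const_mul _).measurable
  refine Measure.le_iff.2 fun s hs => ?_
  rw [Measure.map_apply hmm hs, Weight.meas, withDensity_apply _ (hmm hs),
    Measure.smul_apply, withDensity_apply _ hs, smul_eq_mul, ← lintegral_const_mul _ hm,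
    ← lintegral_indicator (hmm hs), ← lintegral_indicator hs,
    ← lintegral_mul_left_eq_self _ y]
  refine lintegral_mono fun x => ?_
  by_cases hx : x ∈ s
  · simp only [Set.indicator, Set.mem_preimage, inv_mul_cancel_left, hx, if_true]
    exact_mod_cast ω.mul_le' y x
  · simp [Set.indicator, hx]

theorem Weight.memLp_translate (y : G) {f : G → ℂ} (hf : MemLp f 1 (ω.meas μ)) :
    MemLp (fun x => f (y⁻¹ * x)) 1 (ω.meas μ) :=
  (hf.of_measure_le_smul ENNReal.coe_ne_top (ω.map_meas_le y)).comp_measurePreserving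
    ⟨(continuous_const_mul _).measurable, rfl⟩

theorem Weight.eLpNorm_translate_le (y : G) {f : G → ℂ} (hf : MemLp f 1 (ω.meas μ)) :
    eLpNorm (fun x => f (y⁻¹ * x)) 1 (ω.meas μ) ≤ ω y * eLpNorm f 1 (ω.meas μ) := by
  have h := eLpNorm_le_of_measure_le_smul (p := 1) (f := f) (ω.map_meas_le (μ := μ) y)
  have h2 : eLpNorm (fun x => f (y⁻¹ * x)) 1 (ω.meas μ) =
      eLpNorm f 1 ((ω.meas μ).map (fun x => y⁻¹ * x)) :=
    eLpNorm_comp_measurePreserving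
      (hf.of_measure_le_smul ENNReal.coe_ne_top (ω.map_meas_le y)).1
      ⟨(continuous_const_mul _).measurable, rfl⟩
  rw [h2]
  simpa using h

theorem Weight.quasi (y : G) : Measure.QuasiMeasurePreserving (fun x : G => y⁻¹ * x)
    (ω.meas μ) (ω.meas μ) :=
  ⟨(continuous_const_mul _).measurable,
    Measure.absolutelyContinuous_of_le_smul (ω.map_meas_le y)⟩

/-- Left translation `f ↦ δ_y * f`, that is `(δ_y * f) x = f (y⁻¹ x)`, on `L¹(G, ω)`. -/
def BeurlingSpace.translate (y : G) : BeurlingSpace μ ω →L[ℂ] BeurlingSpace μ ω :=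
  LinearMap.mkContinuous
    { toFun := fun f => (ω.memLp_translate y (Lp.memLp f)).toLp (fun x => f (y⁻¹ * x))
      map_add' := fun f g => by
        ext1
        filter_upwards [MemLp.coeFn_toLp (ω.memLp_translate y (Lp.memLp (f + g))),
          MemLp.coeFn_toLp (ω.memLp_translate y (Lp.memLp f)),
          MemLp.coeFn_toLp (ω.memLp_translate y (Lp.memLp g)),
          (ω.quasi y).ae (Lp.coeFn_add f g),
          Lp.coeFn_add ((ω.memLp_translate y (Lp.memLp f)).toLp (fun x => f (y⁻¹ * x)))
            ((ω.memLp_translate y (Lp.memLp g)).toLp (fun x => g (y⁻¹ * x)))]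
          with x h1 h2 h3 h4 h5
        rw [h1, h5, Pi.add_apply, h2, h3, h4, Pi.add_apply]
      map_smul' := fun c f => by
        ext1
        filter_upwards [MemLp.coeFn_toLp (ω.memLp_translate y (Lp.memLp (c • f))),
          MemLp.coeFn_toLp (ω.memLp_translate y (Lp.memLp f)),
          (ω.quasi y).ae (Lp.coeFn_smul c f),
          Lp.coeFn_smul c ((ω.memLp_translate y (Lp.memLp f)).toLp (fun x => f (y⁻¹ * x)))]
          with x h1 h2 h4 h5
        rw [h1, RingHom.id_apply, h5, Pi.smul_apply, h2, h4, Pi.smul_apply] }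
    (ω y : ℝ) fun f => by
      have h := ω.eLpNorm_translate_le y (Lp.memLp f)
      change ‖(ω.memLp_translate y (Lp.memLp f)).toLp (fun x => f (y⁻¹ * x))‖ ≤ _
      rw [Lp.norm_toLp, Lp.norm_def]
      rw [← ENNReal.coe_toReal, ← ENNReal.toReal_mul]
      exact ENNReal.toReal_mono (ENNReal.mul_ne_top ENNReal.coe_ne_top (Lp.eLpNorm_ne_top f)) h

theorem BeurlingSpace.translate_ae (y : G) (f : BeurlingSpace μ ω) :
    BeurlingSpace.translate ω y f =ᵐ[ω.meas μ] fun x => f (y⁻¹ * x) :=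
  MemLp.coeFn_toLp (ω.memLp_translate y (Lp.memLp f))

theorem BeurlingSpace.norm_translate_le (y : G) (f : BeurlingSpace μ ω) :
    ‖BeurlingSpace.translate ω y f‖ ≤ ω y * ‖f‖ :=
  (BeurlingSpace.translate ω y).le_of_opNorm_le
    (LinearMap.mkContinuous_norm_le _ (NNReal.coe_nonneg _) _) f

theorem Weight.ae_iff (p : G → Prop) : (∀ᵐ x ∂(ω.meas μ), p x) ↔ ∀ᵐ x ∂μ, p x := by
  rw [Weight.meas, ae_withDensity_iff (ω.continuous'.measurable).coe_nnreal_ennreal]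
  simp [(ω.pos' _).ne']

instance : IsFiniteMeasureOnCompacts (ω.meas μ) where
  lt_top_of_isCompact K hK := by
    obtain ⟨C, hC⟩ := hK.bddAbove_image ω.continuous'.continuousOn
    rw [Weight.meas, withDensity_apply _ hK.measurableSet]
    refine lt_of_le_of_lt (setLIntegral_mono (g := fun _ => (C : ℝ≥0∞)) measurable_const
      fun x hx => ?_) ?_
    · exact_mod_cast hC (Set.mem_image_of_mem _ hx)
    · rw [setLIntegral_const]
      exact ENNReal.mul_lt_top ENNReal.coe_lt_top hK.measure_lt_top

theorem Weight.dense_aux {f : G → ℂ} (hf : MemLp f 1 μ) {ε : ℝ≥0∞}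
    (hε : ε ≠ 0) :
    ∃ g : G → ℂ, eLpNorm (f - g) 1 μ ≤ ε ∧ (Continuous g ∧ HasCompactSupport g) := by
  refine hf.induction_dense ENNReal.one_ne_top _ ?_ ?_ ?_ hε
  · intro c s hs hsμ ε hε
    obtain ⟨η, η_pos, hη⟩ := exists_eLpNorm_indicator_le (μ := μ) (p := 1) ENNReal.one_ne_top c hε
    have h2 : ((η / 2 : ℝ≥0) : ℝ≥0∞) ≠ 0 := by simpa using η_pos.ne'
    obtain ⟨K, hKs, hK, hKμ⟩ := hs.exists_isCompact_sdiff_lt hsμ.ne h2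
    obtain ⟨U, hsU, hU, -, hUμ⟩ := hs.exists_isOpen_sdiff_lt hsμ.ne h2
    obtain ⟨φ, hφ1, hφ0, hφc, hφ⟩ := exists_continuous_one_zero_of_isCompact hK hU.isClosed_compl
      (Set.disjoint_compl_right_iff_subset.2 (hKs.trans hsU))
    refine ⟨fun x => φ x • c, ?_, φ.continuous.smul continuous_const, hφc.smul_right⟩
    refine le_trans (eLpNorm_mono fun x => ?_) (hη (U \ K) ?_)
    · by_cases hxK : x ∈ K
      · simp [hφ1 hxK, hKs hxK]
      · by_cases hxU : x ∈ U
        · have := hφ x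
          rw [Set.indicator_of_mem (Set.mem_sdiff_of_mem hxU hxK)]
          by_cases hxs : x ∈ s
          · have e : φ x • c - c = (φ x - 1) • c := by rw [sub_smul, one_smul]
            simp only [Pi.sub_apply, Set.indicator_of_mem hxs, e, norm_smul]
            refine mul_le_of_le_one_left (norm_nonneg _) ?_
            rw [Real.norm_eq_abs, abs_le]
            constructor <;> linarith [this.1, this.2]
          · simp only [Pi.sub_apply, Set.indicator_of_notMem hxs, sub_zero, norm_smul]
            refine mul_le_of_le_one_left (norm_nonneg _) ?_
            rw [Real.norm_eq_abs, abs_le]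
            constructor <;> linarith [this.1, this.2]
        · have : φ x = 0 := hφ0 hxU
          simp [this, Set.indicator_of_notMem (fun h => hxU (hsU h))]
    · calc μ (U \ K) ≤ μ ((U \ s) ∪ (s \ K)) := measure_mono fun x hx => by
            by_cases hxs : x ∈ s
            · exact Or.inr ⟨hxs, hx.2⟩
            · exact Or.inl ⟨hx.1, hxs⟩
        _ ≤ _ := measure_union_le _ _
        _ ≤ ((η / 2 : ℝ≥0) : ℝ≥0∞) + ((η / 2 : ℝ≥0) : ℝ≥0∞) := add_le_add hUμ.le hKμ.le
        _ = η := by rw [← ENNReal.coe_add, add_halves]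
  · rintro f g ⟨hf, hf'⟩ ⟨hg, hg'⟩
    exact ⟨hf.add hg, hf'.add hg'⟩
  · rintro f ⟨hf, hf'⟩
    exact (hf.stronglyMeasurable_of_hasCompactSupport hf').aestronglyMeasurable

theorem BeurlingSpace.memLp_cc {h : G → ℂ} (hc : Continuous h) (hs : HasCompactSupport h) :
    MemLp h 1 (ω.meas μ) := hc.memLp_of_hasCompactSupport hs

theorem Weight.integrable_smul {f : G → ℂ} (hf : MemLp f 1 (ω.meas μ)) :
    Integrable (fun x => (ω x : ℝ) • f x) μ := by
  have := (integrable_withDensity_iff_integrable_smul (ω.continuous'.measurable)).1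
    (memLp_one_iff_integrable.1 hf)
  simpa [NNReal.smul_def] using this

theorem Weight.eLpNorm_eq (f : G → ℂ) (hf : AEStronglyMeasurable f (ω.meas μ)) :
    eLpNorm f 1 (ω.meas μ) = eLpNorm (fun x => (ω x : ℝ) • f x) 1 μ := by
  have hm : AEMeasurable (fun x => (ω x : ℝ≥0∞)) μ :=
    (ω.continuous'.measurable).coe_nnreal_ennreal.aemeasurable
  have hf' : AEStronglyMeasurable f (μ.withDensity fun x => (ω x : ℝ≥0∞)) := hf
  rw [eLpNorm_one_eq_lintegral_enorm, eLpNorm_one_eq_lintegral_enorm, Weight.meas,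
    lintegral_withDensity_eq_lintegral_mul₀' hm hf'.enorm]
  refine lintegral_congr fun x => ?_
  rw [enorm_smul, Real.enorm_eq_ofReal (NNReal.coe_nonneg _), ENNReal.ofReal_coe_nnreal]
  rfl

theorem BeurlingSpace.norm_eq (f : BeurlingSpace μ ω) : ‖f‖ = ∫ x, ‖f x‖ * ω x ∂μ := by
  have h : ‖f‖ = (eLpNorm f 1 (ω.meas μ)).toReal := rfl
  rw [h, ω.eLpNorm_eq f (Lp.memLp f).1, eLpNorm_one_eq_lintegral_enorm,
    integral_eq_lintegral_of_nonneg_ae (ae_of_all _ fun x => by positivity)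
      ((ω.integrable_smul (Lp.memLp f)).norm.1.congr (ae_of_all _ fun x => by
        simp [mul_comm]))]
  congr 1
  refine lintegral_congr fun x => ?_
  rw [enorm_smul, mul_comm, ENNReal.ofReal_mul (norm_nonneg _), ofReal_norm]
  simp

theorem BeurlingSpace.exists_cc (f : BeurlingSpace μ ω) {ε : ℝ} (hε : 0 < ε) :
    ∃ (h : G → ℂ) (hm : MemLp h 1 (ω.meas μ)), Continuous h ∧ HasCompactSupport h ∧
      ‖f - hm.toLp h‖ ≤ ε := by
  obtain ⟨g, hg, hgc, hgs⟩ := Weight.dense_aux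
    (memLp_one_iff_integrable.2 (ω.integrable_smul (Lp.memLp f))) (ε := ENNReal.ofReal ε)
    (by simpa using hε)
  have hωc : Continuous fun x => ((ω x : ℝ)⁻¹) :=
    (NNReal.continuous_coe.comp ω.continuous').inv₀ fun x => NNReal.coe_ne_zero.2 (ω.pos' x).ne'
  obtain ⟨k, hk⟩ : ∃ k : G → ℂ, k = fun x => (ω x : ℝ)⁻¹ • g x := ⟨_, rfl⟩
  have hc : Continuous k := by rw [hk]; exact hωc.smul hgc
  have hs : HasCompactSupport k := by rw [hk]; exact hgs.smul_left (f := fun x => (ω x : ℝ)⁻¹)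
  have hm : MemLp k 1 (ω.meas μ) := BeurlingSpace.memLp_cc (μ := μ) ω hc hs
  refine ⟨k, hm, hc, hs, ?_⟩
  have e : eLpNorm ((f : G → ℂ) - k) 1 (ω.meas μ)
      ≤ ENNReal.ofReal ε := by
    rw [ω.eLpNorm_eq _ ((Lp.memLp f).1.sub hm.1)]
    refine le_trans (le_of_eq ?_) hg
    congr 1
    ext x
    have : (ω x : ℝ) ≠ 0 := NNReal.coe_ne_zero.2 (ω.pos' x).ne'
    simp only [Pi.sub_apply, hk, smul_sub, smul_inv_smul₀ this]
  rw [Lp.norm_def]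
  refine ENNReal.toReal_le_of_le_ofReal hε.le (le_trans (le_of_eq (eLpNorm_congr_ae ?_)) e)
  filter_upwards [Lp.coeFn_sub f (hm.toLp k), hm.coeFn_toLp] with x h1 h2
  rw [h1, Pi.sub_apply, h2, Pi.sub_apply]

theorem BeurlingSpace.aestronglyMeasurable_smul {E : Type*} [NormedAddCommGroup E]
    [NormedSpace ℂ E] (f : BeurlingSpace μ ω) {Φ : G → E} (hΦ : Continuous Φ) :
    AEStronglyMeasurable (fun y => f y • Φ y) μ := by
  have key : ∀ n : ℕ, ∃ (h : G → ℂ) (hm : MemLp h 1 (ω.meas μ)), Continuous h ∧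
      HasCompactSupport h ∧ ‖f - hm.toLp h‖ ≤ 1 / ((n : ℝ) + 1) :=
    fun n => BeurlingSpace.exists_cc ω f (by positivity)
  choose h hm hc hs hn using key
  have ht : Tendsto (fun n => (hm n).toLp (h n)) atTop (𝓝 f) := by
    rw [tendsto_iff_norm_sub_tendsto_zero]
    refine squeeze_zero (fun _ => norm_nonneg _) (fun n => ?_) tendsto_one_div_add_atTop_nhds_zero_nat
    rw [norm_sub_rev]
    exact hn n
  obtain ⟨ns, -, hns⟩ := (tendstoInMeasure_of_tendsto_Lp ht).exists_seq_tendsto_ae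
  refine aestronglyMeasurable_of_tendsto_ae (u := atTop)
    (f := fun n y => h (ns n) y • Φ y) (fun n => ?_) ?_
  · exact (((hc _).smul hΦ).stronglyMeasurable_of_hasCompactSupport
      (hs _).smul_right).aestronglyMeasurable
  · have h1 := (ω.ae_iff (μ := μ) _).1 hns
    have h2 : ∀ᵐ x ∂μ, ∀ n, (hm n).toLp (h n) x = h n x :=
      ae_all_iff.2 fun n => (ω.ae_iff (μ := μ) _).1 (hm n).coeFn_toLp
    filter_upwards [h1, h2] with x h1 h2
    simp only [h2] at h1
    exact h1.smul_const _

theorem BeurlingSpace.integrable_smul {E : Type*} [NormedAddCommGroup E]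
    [NormedSpace ℂ E] (f : BeurlingSpace μ ω) {Φ : G → E} (hΦ : Continuous Φ) {C : ℝ}
    (hC : ∀ y, ‖Φ y‖ ≤ ω y * C) : Integrable (fun y => f y • Φ y) μ := by
  refine ((ω.integrable_smul (Lp.memLp f)).norm.mul_const C).mono'
    (BeurlingSpace.aestronglyMeasurable_smul ω f hΦ) (ae_of_all _ fun y => ?_)
  rw [norm_smul, norm_smul, Real.norm_eq_abs, abs_of_nonneg (NNReal.coe_nonneg _)]
  calc ‖f y‖ * ‖Φ y‖ ≤ ‖f y‖ * (ω y * C) := by gcongr; exact hC y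
    _ = _ := by ring

theorem BeurlingSpace.continuous_translate (f : BeurlingSpace μ ω) :
    Continuous fun y => BeurlingSpace.translate ω y f := by
  have cc : ∀ (h : G → ℂ) (hm : MemLp h 1 (ω.meas μ)), Continuous h → HasCompactSupport h →
      Continuous fun y => BeurlingSpace.translate ω y (hm.toLp h) := by
    intro h hm hc hs
    refine continuous_iff_continuousAt.2 fun y₀ => ?_
    obtain ⟨t, ht, hty⟩ := exists_compact_mem_nhds y₀
    have hcont : ContinuousOn
        (fun y => ∫ x, ‖h (y⁻¹ * x) - h (y₀⁻¹ * x)‖ ∂(ω.meas μ)) t := by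
      refine continuousOn_integral_of_compact_support 
        (k := (fun p : G × G => p.1 * p.2) '' (t ×ˢ tsupport h))
        ((ht.prod hs).image continuous_mul) ?_ ?_
      · refine Continuous.continuousOn ?_
        simp only [Function.uncurry_def]
        fun_prop
      · intro p x hp hx
        have h0 : ∀ q ∈ t, h (q⁻¹ * x) = 0 := fun q hq => by
          by_contra hne
          exact hx ⟨(q, q⁻¹ * x), ⟨hq, subset_tsupport _ hne⟩, by simp⟩
        simp [h0 p hp, h0 y₀ (mem_of_mem_nhds hty)]
    have hcont' := (hcont.continuousAt hty).tendsto
    simp only [sub_self, norm_zero, integral_zero] at hcont'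
    rw [ContinuousAt, tendsto_iff_norm_sub_tendsto_zero]
    refine hcont'.congr fun y => ?_
    rw [L1.norm_eq_integral_norm]
    refine integral_congr_ae ?_
    filter_upwards [Lp.coeFn_sub (BeurlingSpace.translate ω y (hm.toLp h))
        (BeurlingSpace.translate ω y₀ (hm.toLp h)),
      BeurlingSpace.translate_ae ω y (hm.toLp h), BeurlingSpace.translate_ae ω y₀ (hm.toLp h),
      (ω.quasi y).ae hm.coeFn_toLp, (ω.quasi y₀).ae hm.coeFn_toLp] with x h1 h2 h3 h4 h5
    rw [h1, Pi.sub_apply, h2, h3, h4, h5]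
  have key : ∀ n : ℕ, ∃ (h : G → ℂ) (hm : MemLp h 1 (ω.meas μ)), Continuous h ∧
      HasCompactSupport h ∧ ‖f - hm.toLp h‖ ≤ 1 / ((n : ℝ) + 1) :=
    fun n => BeurlingSpace.exists_cc ω f (by positivity)
  choose h hm hc hs hn using key
  have hloc : TendstoLocallyUniformly
      (fun n y => BeurlingSpace.translate ω y ((hm n).toLp (h n)))
      (fun y => BeurlingSpace.translate ω y f) atTop := by
    rw [Metric.tendstoLocallyUniformly_iff]
    intro ε hε y₀
    refine ⟨{y | ω y < ω y₀ + 1}, ?_, ?_⟩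
    · exact (isOpen_lt ω.continuous' continuous_const).mem_nhds (by simp)
    · have hlim : Tendsto (fun n : ℕ => ((ω y₀ + 1 : ℝ≥0) : ℝ) * (1 / ((n : ℝ) + 1)))
          atTop (𝓝 0) := by
        simpa using tendsto_one_div_add_atTop_nhds_zero_nat.const_mul ((ω y₀ + 1 : ℝ≥0) : ℝ)
      filter_upwards [hlim.eventually_lt_const hε] with n hlt y hy
      rw [dist_eq_norm, ← map_sub]
      refine lt_of_le_of_lt (BeurlingSpace.norm_translate_le ω y _) (lt_of_le_of_lt ?_ hlt)
      exact mul_le_mul (NNReal.coe_le_coe.2 (le_of_lt hy)) (hn n) (norm_nonneg _)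
        (NNReal.coe_nonneg _)
  exact hloc.continuous (Frequently.of_forall fun n => cc _ (hm n) (hc n) (hs n))

theorem BeurlingSpace.translate_translate (x y : G) (f : BeurlingSpace μ ω) :
    BeurlingSpace.translate ω x (BeurlingSpace.translate ω y f) =
      BeurlingSpace.translate ω (x * y) f := by
  ext1
  filter_upwards [BeurlingSpace.translate_ae ω x (BeurlingSpace.translate ω y f),
    (ω.quasi x).ae (BeurlingSpace.translate_ae ω y f),
    BeurlingSpace.translate_ae ω (x * y) f] with z h1 h2 h3
  rw [h1, h2, h3, mul_inv_rev, mul_assoc]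

/-- The convolution product `(f * g) x = ∫ f y g (y⁻¹ x) dμ y`, as the (absolutely convergent)
integral `f * g = ∫ f y (δ_y * g) dμ y` in the Banach space `L¹(G, ω)`. -/
def BeurlingSpace.conv (f g : BeurlingSpace μ ω) : BeurlingSpace μ ω :=
  ∫ y, f y • BeurlingSpace.translate ω y g ∂μ

theorem BeurlingSpace.conv_integrable (f g : BeurlingSpace μ ω) :
    Integrable (fun y => f y • BeurlingSpace.translate ω y g) μ :=
  BeurlingSpace.integrable_smul ω f (BeurlingSpace.continuous_translate ω g)
    fun y => BeurlingSpace.norm_translate_le ω y g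

theorem BeurlingSpace.conv_add_left (f f' g : BeurlingSpace μ ω) :
    BeurlingSpace.conv ω (f + f') g = BeurlingSpace.conv ω f g + BeurlingSpace.conv ω f' g := by
  rw [conv, conv, conv, ← integral_add (conv_integrable ω f g) (conv_integrable ω f' g)]
  refine integral_congr_ae ?_
  filter_upwards [(ω.ae_iff (μ := μ) _).1 (Lp.coeFn_add f f')] with y hy
  rw [hy, Pi.add_apply, add_smul]

theorem BeurlingSpace.conv_smul_left (c : ℂ) (f g : BeurlingSpace μ ω) :
    BeurlingSpace.conv ω (c • f) g = c • BeurlingSpace.conv ω f g := by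
  rw [conv, conv, ← integral_smul]
  refine integral_congr_ae ?_
  filter_upwards [(ω.ae_iff (μ := μ) _).1 (Lp.coeFn_smul c f)] with y hy
  rw [hy, Pi.smul_apply, smul_assoc]

theorem BeurlingSpace.conv_add_right (f g g' : BeurlingSpace μ ω) :
    BeurlingSpace.conv ω f (g + g') = BeurlingSpace.conv ω f g + BeurlingSpace.conv ω f g' := by
  rw [conv, conv, conv, ← integral_add (conv_integrable ω f g) (conv_integrable ω f g')]
  simp only [map_add, smul_add]

theorem BeurlingSpace.conv_smul_right (c : ℂ) (f g : BeurlingSpace μ ω) :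
    BeurlingSpace.conv ω f (c • g) = c • BeurlingSpace.conv ω f g := by
  rw [conv, conv, ← integral_smul]
  simp only [map_smul, smul_comm c]

theorem BeurlingSpace.norm_conv_le (f g : BeurlingSpace μ ω) :
    ‖BeurlingSpace.conv ω f g‖ ≤ ‖f‖ * ‖g‖ := by
  rw [conv, BeurlingSpace.norm_eq ω f, ← integral_mul_const]
  refine norm_integral_le_of_norm_le ?_ (ae_of_all _ fun y => ?_)
  · refine ((ω.integrable_smul (Lp.memLp f)).norm.congr (ae_of_all _ fun x => ?_)).mul_const _
    simp [mul_comm]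
  · rw [norm_smul, mul_assoc]
    exact mul_le_mul_of_nonneg_left (norm_translate_le ω y g) (norm_nonneg _)

theorem BeurlingSpace.translate_conv (x : G) (f g : BeurlingSpace μ ω) :
    BeurlingSpace.conv ω (BeurlingSpace.translate ω x f) g =
      BeurlingSpace.translate ω x (BeurlingSpace.conv ω f g) := by
  rw [conv, conv, ← ContinuousLinearMap.integral_comp_comm _ (conv_integrable ω f g),
    ← integral_mul_left_eq_self (μ := μ) _ x]
  refine integral_congr_ae ?_
  have h := (ω.ae_iff (μ := μ) _).1 (translate_ae ω x f)
  have h' := (measurePreserving_mul_left μ x).quasiMeasurePreserving.ae h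
  filter_upwards [h'] with y hy
  rw [hy, map_smul, translate_translate, inv_mul_cancel_left]

theorem BeurlingSpace.conv_assoc (f g h : BeurlingSpace μ ω) :
    BeurlingSpace.conv ω (BeurlingSpace.conv ω f g) h =
      BeurlingSpace.conv ω f (BeurlingSpace.conv ω g h) := by
  let T : BeurlingSpace μ ω →L[ℂ] BeurlingSpace μ ω := LinearMap.mkContinuous
    { toFun := fun k => conv ω k h
      map_add' := fun a b => conv_add_left ω a b h
      map_smul' := fun c a => conv_smul_left ω c a h } ‖h‖ fun k => by
        rw [mul_comm]; exact norm_conv_le ω k h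
  have hT : ∀ k, conv ω k h = T k := fun _ => rfl
  rw [hT, conv, ← ContinuousLinearMap.integral_comp_comm _ (conv_integrable ω f g), conv]
  refine integral_congr_ae (ae_of_all _ fun y => ?_)
  simp only [← hT]
  rw [conv_smul_left, translate_conv]

/-- The Beurling algebra `L¹(G, ω)`: the Banach space `L¹(G, ω)` with the convolution product. -/
def BeurlingAlgebra (μ : Measure G) (ω : Weight G) : Type u := BeurlingSpace μ ω

variable (μ)

instance : NormedAddCommGroup (BeurlingAlgebra μ ω) :=
  inferInstanceAs (NormedAddCommGroup (BeurlingSpace μ ω))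

instance : NormedSpace ℂ (BeurlingAlgebra μ ω) :=
  inferInstanceAs (NormedSpace ℂ (BeurlingSpace μ ω))

instance : CompleteSpace (BeurlingAlgebra μ ω) :=
  inferInstanceAs (CompleteSpace (BeurlingSpace μ ω))

instance : NonUnitalNormedRing (BeurlingAlgebra μ ω) :=
  { (inferInstance : NormedAddCommGroup (BeurlingAlgebra μ ω)) with
    mul := BeurlingSpace.conv ω
    left_distrib := BeurlingSpace.conv_add_right ω
    right_distrib := BeurlingSpace.conv_add_left ω
    zero_mul := fun f => by
      have h := BeurlingSpace.conv_smul_left ω (μ := μ) 0 0 f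
      rwa [zero_smul, zero_smul] at h
    mul_zero := fun f => by
      have h := BeurlingSpace.conv_smul_right ω (μ := μ) 0 f 0
      rwa [zero_smul, zero_smul] at h
    mul_assoc := BeurlingSpace.conv_assoc ω
    norm_mul_le := BeurlingSpace.norm_conv_le ω }

theorem BeurlingAlgebra.mul_def (f g : BeurlingAlgebra μ ω) :
    f * g = BeurlingSpace.conv ω f g := rfl

instance : IsScalarTower ℂ (BeurlingAlgebra μ ω) (BeurlingAlgebra μ ω) :=
  ⟨fun c f g => BeurlingSpace.conv_smul_left ω c f g⟩

instance : SMulCommClass ℂ (BeurlingAlgebra μ ω) (BeurlingAlgebra μ ω) :=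
  ⟨fun c f g => (BeurlingSpace.conv_smul_right ω c f g).symm⟩

end Beurling

section Amenable

variable {G : Type u} [Group G] [TopologicalSpace G] [IsTopologicalGroup G] [MeasurableSpace G]
  [BorelSpace G]

variable (G) in
/-- The space of bounded Borel functions `G → ℝ`. -/
def boundedBorel : Submodule ℝ (G → ℝ) where
  carrier := {f | Measurable f ∧ ∃ C, ∀ x, |f x| ≤ C}
  add_mem' := by
    rintro f g ⟨hf, C, hC⟩ ⟨hg, D, hD⟩
    exact ⟨hf.add hg, C + D, fun x => (abs_add_le _ _).trans (add_le_add (hC x) (hD x))⟩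
  zero_mem' := ⟨measurable_const, 0, fun x => by simp⟩
  smul_mem' := by
    rintro c f ⟨hf, C, hC⟩
    refine ⟨hf.const_smul c, |c| * C, fun x => ?_⟩
    simp only [Pi.smul_apply, smul_eq_mul, abs_mul]
    exact mul_le_mul_of_nonneg_left (hC x) (abs_nonneg c)

/-- The constant function `1`. -/
def boundedBorel.one : boundedBorel G := ⟨fun _ => 1, measurable_const, 1, fun x => by simp⟩

/-- The left translate `x ↦ f (g x)`. -/
def boundedBorel.translate (g : G) (f : boundedBorel G) : boundedBorel G :=
  ⟨fun x => f.1 (g * x), f.2.1.comp (continuous_const_mul g).measurable,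
    f.2.2.imp fun _ hC x => hC (g * x)⟩

/-- A left-invariant mean on `L^∞(G)`, where `L^∞(G)` is the space of bounded Borel functions modulo
those that vanish locally almost everywhere (almost everywhere on each compact set) for the Haar
measure `μ`. Positivity with respect to the locally-a.e. order makes the functional well defined on
these classes. -/
structure LeftInvariantMean (μ : Measure G) where
  toFun : boundedBorel G →ₗ[ℝ] ℝ
  map_one : toFun boundedBorel.one = 1
  nonneg : ∀ f : boundedBorel G,
    (∀ K : Set G, IsCompact K → ∀ᵐ x ∂(μ.restrict K), 0 ≤ f.1 x) → 0 ≤ toFun f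
  map_translate : ∀ (g : G) (f : boundedBorel G), toFun (boundedBorel.translate g f) = toFun f

/-- A locally compact group with left Haar measure `μ` is amenable if there is a left-invariant mean
on `L^∞(G)`. -/
def IsAmenableGroup (μ : Measure G) : Prop := Nonempty (LeftInvariantMean μ)

end Amenable

end

/-! Write `A` for the Beurling algebra. Since `ω ≥ c > 0`, the space `L¹(G, ω)` maps continuously
into `L¹(G)`, so `φ f = ∫ f dμ` is a nonzero continuous character of `A`. Applying `id ⊗ φ` to an
approximate diagonal gives `u i` in `A` with `a * u i - φ a • u i → 0` and `φ (u i) → 1`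
(`PseudoAmenable.exists_net_of_character`). Testing this on `a` and on `δ_g * a`, where `φ a = 1`,
gives `δ_g * u i - u i → 0` in `A` (`BeurlingSpace.tendsto_translate_sub`), hence in `L¹(G)`.

The densities `|u i|` are therefore asymptotically left-invariant, and their mass is eventually at
least `1/2` because `φ (u i) → 1`. No upper bound on the net is needed: dividing by a mass bounded
below preserves asymptotic invariance, and an ultrafilter limit of the normalized averages is an
invariant mean (`IsAmenableGroup.of_asymptotically_invariant`). -/

noncomputable section

/-! ### Slicing an approximate diagonal by a character -/

section Slice

variable {A : Type u} [NonUnitalNormedRing A] [NormedSpace ℂ A] [IsScalarTower ℂ A A]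
  [SMulCommClass ℂ A A]

/-- The continuous multilinear map `(b, c) ↦ φ c • b`. -/
def sliceMultilinear (φ : A →L[ℂ] ℂ) : ContinuousMultilinearMap ℂ (fun _ : Fin 2 => A) A where
  toFun v := φ (v 1) • v 0
  map_update_add' v i x y := by
    -- The field quantifies over all decidability instances; fixing the concrete one lets `simp`
    -- evaluate `Function.update`.
    have : ‹DecidableEq (Fin 2)› = instDecidableEqFin 2 := Subsingleton.elim _ _
    subst this
    fin_cases i <;> simp [add_smul]
  map_update_smul' v i c x := by
    have : ‹DecidableEq (Fin 2)› = instDecidableEqFin 2 := Subsingleton.elim _ _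
    subst this
    fin_cases i <;> simp [smul_smul, mul_comm]
  cont := by fun_prop

/-- The slice map `id ⊗ φ : A ⊗̂ A → A`, `b ⊗ c ↦ φ c • b`. -/
def ProjTensor.slice [CompleteSpace A] (φ : A →L[ℂ] ℂ) : ProjTensor A →L[ℂ] A :=
  (PiTensorProduct.liftIsometry ℂ (fun _ : Fin 2 => A) A (sliceMultilinear φ)).fromCompletion

theorem ProjTensor.slice_tprod [CompleteSpace A] (φ : A →L[ℂ] ℂ) (v : Fin 2 → A) :
    ProjTensor.slice φ (PiTensorProduct.tprod ℂ v : ⨂[ℂ] _ : Fin 2, A) = φ (v 1) • v 0 := by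
  simp [slice, sliceMultilinear]

/-- Continuous linear maps on `A ⊗̂ A` that agree on elementary tensors are equal. -/
theorem ProjTensor.clm_ext {F : Type*} [NormedAddCommGroup F] [NormedSpace ℂ F]
    {S T : ProjTensor A →L[ℂ] F}
    (h : ∀ v : Fin 2 → A, S (PiTensorProduct.tprod ℂ v : ⨂[ℂ] _ : Fin 2, A) =
      T (PiTensorProduct.tprod ℂ v : ⨂[ℂ] _ : Fin 2, A)) : S = T := by
  ext m
  induction m using UniformSpace.Completion.induction_on with
  | hp => exact isClosed_eq S.continuous T.continuous
  | ih t =>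
    induction t using PiTensorProduct.induction_on with
    | smul_tprod r v => rw [UniformSpace.Completion.coe_smul, map_smul, map_smul, h]
    | add x y hx hy => rw [UniformSpace.Completion.coe_add, map_add, map_add, hx, hy]

variable [CompleteSpace A] {φ : A →L[ℂ] ℂ}

/-- The left action only touches the factor that the slice leaves alone, so `φ` need not be
multiplicative. -/
theorem ProjTensor.slice_leftAct (a : A) (m : ProjTensor A) :
    ProjTensor.slice φ (ProjTensor.leftAct a m) = a * ProjTensor.slice φ m := by
  refine DFunLike.congr_fun (ProjTensor.clm_ext (S := (slice φ).comp (leftAct a))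
    (T := (ContinuousLinearMap.mul ℂ A a).comp (slice φ)) fun v => ?_) m
  simp only [ContinuousLinearMap.comp_apply, leftAct_tprod, slice_tprod,
    ContinuousLinearMap.mul_apply', mul_smul_comm]
  rfl

/-- The right action only touches the factor that `φ` evaluates, so it becomes a scalar. This turns
asymptotic commutation with `m` into an approximate eigenvector equation in `A`. -/
theorem ProjTensor.slice_rightAct (hφ : ∀ a b, φ (a * b) = φ a * φ b) (a : A)
    (m : ProjTensor A) :
    ProjTensor.slice φ (ProjTensor.rightAct a m) = φ a • ProjTensor.slice φ m := by
  refine DFunLike.congr_fun (ProjTensor.clm_ext (S := (slice φ).comp (rightAct a))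
    (T := φ a • slice φ) fun v => ?_) m
  simp only [ContinuousLinearMap.comp_apply, rightAct_tprod, slice_tprod,
    smul_apply, smul_smul]
  simp [hφ, mul_comm]

/-- Both sides send `b ⊗ c` to `φ b * φ c`. -/
theorem ProjTensor.map_slice (hφ : ∀ a b, φ (a * b) = φ a * φ b) (m : ProjTensor A) :
    φ (ProjTensor.slice φ m) = φ (ProjTensor.mulMap A m) := by
  refine DFunLike.congr_fun (ProjTensor.clm_ext (S := φ.comp (slice φ))
    (T := φ.comp (mulMap A)) fun v => ?_) m
  simp only [ContinuousLinearMap.comp_apply, mulMap_tprod, slice_tprod]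
  simp [hφ, mul_comm]

/-- A pseudo-amenable Banach algebra with a nonzero character `φ` has a net `u` such that
`a * u i - φ a • u i → 0` for all `a`, and `φ (u i) → 1`. -/
theorem PseudoAmenable.exists_net_of_character (h : PseudoAmenable A)
    (hφ : ∀ a b, φ (a * b) = φ a * φ b) (h0 : φ ≠ 0) :
    ∃ (ι : Type u) (l : Filter ι) (_ : l.NeBot) (u : ι → A),
      (∀ a, Tendsto (fun i => a * u i - φ a • u i) l (𝓝 0)) ∧
        Tendsto (fun i => φ (u i)) l (𝓝 1) := by
  obtain ⟨ι, _, _, _, m, hm⟩ := h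
  refine ⟨ι, atTop, inferInstance, fun i => ProjTensor.slice φ (m i), fun a => ?_, ?_⟩
  · have := ((ProjTensor.slice φ).continuous.tendsto 0).comp (hm a).1
    simpa only [Function.comp_def, map_sub, map_zero, ProjTensor.slice_leftAct,
      ProjTensor.slice_rightAct hφ] using this
  · obtain ⟨a, ha⟩ : ∃ a, φ a ≠ 0 := by
      by_contra! h
      exact h0 (ContinuousLinearMap.ext h)
    have := ((φ.continuous.tendsto a).comp (hm a).2).const_mul (φ a)⁻¹
    simpa only [Function.comp_def, hφ, inv_mul_cancel_left₀ ha, inv_mul_cancel₀ ha,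
      ProjTensor.map_slice hφ] using this

end Slice

/-! ### From asymptotically invariant densities to an invariant mean -/

section Mean

variable {G : Type u} [Group G] [TopologicalSpace G] [IsTopologicalGroup G]
  [MeasurableSpace G] [BorelSpace G]

/-- A locally a.e. nonnegative bounded Borel function has nonnegative integral against a
nonnegative integrable density. -/
theorem boundedBorel.integral_mul_nonneg [LocallyCompactSpace G] [T2Space G] (μ : Measure G)
    [μ.IsHaarMeasure] [μ.Regular] {p : G → ℝ} (hp : Integrable p μ) (hp0 : 0 ≤ p)
    (f : boundedBorel G)
    (hf : ∀ K : Set G, IsCompact K → ∀ᵐ x ∂(μ.restrict K), 0 ≤ f.1 x) :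
    0 ≤ ∫ x, f.1 x * p x ∂μ := by
  obtain ⟨C, hC⟩ := f.2.2
  have hC0 : 0 ≤ C := (abs_nonneg _).trans (hC 1)
  have hfp : Integrable (fun x => f.1 x * p x) μ :=
    hp.bdd_mul f.2.1.aestronglyMeasurable (ae_of_all _ hC)
  refine le_of_forall_pos_sub_le fun ε hε => ?_
  -- The sign of `f` is known only a.e. on compact sets, and `μ` need not be σ-finite. So `p` is
  -- approximated in `L¹` by a compactly supported `k`, after a cast because `Weight.dense_aux` is
  -- about complex functions. The denominator `C + 1` covers `C = 0`.
  have hpc : Integrable (fun x => (p x : ℂ)) μ := hp.ofReal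
  obtain ⟨k, hk, hkc, hks⟩ := Weight.dense_aux (memLp_one_iff_integrable.2 hpc)
    (ε := ENNReal.ofReal (ε / (C + 1))) (by
      have : 0 < ε / (C + 1) := by positivity
      simpa using this)
  have hki : Integrable k μ := hkc.integrable_of_hasCompactSupport hks
  have hk' : ∫ x, ‖(p x : ℂ) - k x‖ ∂μ ≤ ε / (C + 1) := by
    rw [integral_norm_eq_lintegral_enorm (f := fun x => (p x : ℂ) - k x) (hpc.sub hki).1,
      ← eLpNorm_one_eq_lintegral_enorm]
    exact ENNReal.toReal_le_of_le_ofReal (by positivity) hk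
  have hK := hf _ hks
  rw [ae_restrict_iff' (isClosed_tsupport k).measurableSet] at hK
  -- Pointwise a.e.: on the support of `k` the integrand `f * p` is nonnegative; off it `k = 0`, so
  -- the error term is `C * |p|`.
  have hbound : -(C * ∫ x, ‖(p x : ℂ) - k x‖ ∂μ) ≤ ∫ x, f.1 x * p x ∂μ := by
    rw [← integral_const_mul, ← integral_neg]
    refine integral_mono_ae ((hpc.sub hki).norm.const_mul C).neg hfp ?_
    filter_upwards [hK] with x hx
    by_cases hxK : x ∈ tsupport k
    · have h1 : 0 ≤ f.1 x * p x := mul_nonneg (hx hxK) (hp0 x)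
      have h2 : 0 ≤ C * ‖(p x : ℂ) - k x‖ := by positivity
      linarith
    · have h3 : |f.1 x * p x| ≤ C * |p x| := by
        rw [abs_mul]
        exact mul_le_mul_of_nonneg_right (hC x) (abs_nonneg _)
      simp only [image_eq_zero_of_notMem_tsupport hxK, sub_zero, Complex.norm_real,
        Real.norm_eq_abs]
      exact (neg_le_neg h3).trans (neg_abs_le _)
  have : C * ∫ x, ‖(p x : ℂ) - k x‖ ∂μ ≤ ε := by
    calc C * ∫ x, ‖(p x : ℂ) - k x‖ ∂μ ≤ (C + 1) * (ε / (C + 1)) := by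
          gcongr
          linarith
      _ = ε := by field_simp
  linarith

/-- Asymptotically left-invariant densities, not necessarily bounded in `L¹` but bounded away from
`0` in it, yield a left-invariant mean. -/
theorem IsAmenableGroup.of_asymptotically_invariant [LocallyCompactSpace G] [T2Space G]
    (μ : Measure G) [μ.IsHaarMeasure] [μ.Regular] {ι : Type*} {l : Filter ι} [l.NeBot]
    {p : ι → G → ℝ} (hp : ∀ i, Integrable (p i) μ) (hp0 : ∀ i, 0 ≤ p i) {δ : ℝ} (hδ : 0 < δ)
    (hpδ : ∀ᶠ i in l, δ ≤ ∫ x, p i x ∂μ)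
    (hinv : ∀ g : G, Tendsto (fun i => ∫ x, |p i (g⁻¹ * x) - p i x| ∂μ) l (𝓝 0)) :
    IsAmenableGroup μ := by
  -- Along one ultrafilter all bounded averages converge at once, so the limits depend linearly on
  -- `f`.
  let U : Ultrafilter ι := Ultrafilter.of l
  have hU : (U : Filter ι) ≤ l := Ultrafilter.of_le l
  have hN : ∀ i, 0 ≤ ∫ x, p i x ∂μ := fun i => integral_nonneg (hp0 i)
  have hint : ∀ (f : boundedBorel G) (i : ι), Integrable (fun x => f.1 x * p i x) μ := fun f i => by
    obtain ⟨C, hC⟩ := f.2.2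
    exact (hp i).bdd_mul f.2.1.aestronglyMeasurable (ae_of_all _ hC)
  let b : boundedBorel G → ι → ℝ := fun f i => (∫ x, f.1 x * p i x ∂μ) / ∫ x, p i x ∂μ
  have hconv : ∀ f, ∃ r, Tendsto (b f) U (𝓝 r) := fun f => by
    obtain ⟨C, hC⟩ := f.2.2
    have hC0 : 0 ≤ C := (abs_nonneg _).trans (hC 1)
    have hb : ∀ i, b f i ∈ Set.Icc (-C) C := fun i => by
      rw [Set.mem_Icc, ← abs_le, abs_div, abs_of_nonneg (hN i)]
      -- This form allows zero mass, where the quotient is `0` by convention, so the bound holds for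
      -- every `i`.
      refine div_le_of_le_mul₀ (hN i) hC0 ?_
      rw [← integral_const_mul]
      refine norm_integral_le_of_norm_le (f := fun x => f.1 x * p i x)
        ((hp i).const_mul C) (ae_of_all _ fun x => ?_)
      rw [norm_mul, Real.norm_of_nonneg (hp0 i x)]
      exact mul_le_mul_of_nonneg_right (hC x) (hp0 i x)
    obtain ⟨r, -, hr⟩ := isCompact_Icc.ultrafilter_le_nhds (U.map (b f))
      (le_principal_iff.2 (Ultrafilter.mem_map.2 (Filter.univ_mem' hb)))
    exact ⟨r, hr⟩
  choose M hM using hconv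
  refine ⟨⟨⟨⟨M, fun f g => ?_⟩, fun c f => ?_⟩, ?_, fun f hf => ?_, fun g f => ?_⟩⟩
  · refine tendsto_nhds_unique (hM (f + g)) (((hM f).add (hM g)).congr fun i => ?_)
    simp only [b]
    rw [← add_div, ← integral_add (hint f i) (hint g i)]
    simp [add_mul]
  · refine tendsto_nhds_unique (hM (c • f)) (((hM f).const_mul c).congr fun i => ?_)
    simp only [b]
    rw [← mul_div_assoc, ← integral_const_mul]
    simp [mul_assoc]
  · refine tendsto_nhds_unique (hM boundedBorel.one)
      (tendsto_const_nhds.congr' (hU ?_))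
    filter_upwards [hpδ] with i hi
    simp [b, boundedBorel.one, div_self (hδ.trans_le hi).ne']
  · exact ge_of_tendsto' (hM f) fun i =>
      div_nonneg (boundedBorel.integral_mul_nonneg μ (hp i) (hp0 i) f hf) (hN i)
  · obtain ⟨C, hC⟩ := f.2.2
    have hC0 : 0 ≤ C := (abs_nonneg _).trans (hC 1)
    refine sub_eq_zero.1 (tendsto_nhds_unique ((hM (boundedBorel.translate g f)).sub (hM f)) ?_)
    -- Left invariance of `μ` moves the translation from `f` to `p i`. The numerators then differ by
    -- at most `C * ∫ |p i (g⁻¹ x) - p i x|`, and the denominator is eventually at least `δ`.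
    have hlim := ((hinv g).const_mul (C / δ)).mono_left hU
    rw [mul_zero] at hlim
    refine squeeze_zero_norm' (hU ?_) hlim
    filter_upwards [hpδ] with i hi
    have hpos := hδ.trans_le hi
    have hpg : Integrable (fun x => p i (g⁻¹ * x)) μ := (hp i).comp_mul_left g⁻¹
    have hI : Integrable (fun x => f.1 x * p i (g⁻¹ * x)) μ :=
      hpg.bdd_mul f.2.1.aestronglyMeasurable (ae_of_all _ hC)
    have htr : ∫ x, (boundedBorel.translate g f).1 x * p i x ∂μ
        = ∫ x, f.1 x * p i (g⁻¹ * x) ∂μ := by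
      rw [← integral_mul_left_eq_self (fun x => f.1 x * p i (g⁻¹ * x)) g]
      simp [boundedBorel.translate]
    have hdiff : ‖(∫ x, f.1 x * p i (g⁻¹ * x) ∂μ) - ∫ x, f.1 x * p i x ∂μ‖
        ≤ C * ∫ x, |p i (g⁻¹ * x) - p i x| ∂μ := by
      rw [← integral_sub hI (hint f i), ← integral_const_mul]
      refine norm_integral_le_of_norm_le ((hpg.sub (hp i)).abs.const_mul C)
        (ae_of_all _ fun x => ?_)
      rw [← mul_sub, norm_mul]
      exact mul_le_mul_of_nonneg_right (hC x) (abs_nonneg _)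
    simp only [b]
    rw [← sub_div, norm_div, Real.norm_of_nonneg (hN i), htr, div_mul_eq_mul_div]
    gcongr

end Mean

/-! ### The augmentation character and the invariant net -/

section Character

variable {G : Type u} [Group G] [TopologicalSpace G] [MeasurableSpace G]
  {μ : Measure G} {ω : Weight G} {c : ℝ≥0}

/-- The lower bound on the weight says `c • μ ≤ ω dμ` as measures. -/
theorem BeurlingSpace.integrable (hc : 0 < c) (hω : ∀ x, c ≤ ω x) (f : BeurlingSpace μ ω) :
    Integrable f μ := by
  have h : (c : ℝ≥0∞) • μ ≤ ω.meas μ := by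
    rw [Weight.meas, ← withDensity_const]
    exact withDensity_mono (ae_of_all _ fun x => ENNReal.coe_le_coe.2 (hω x))
  have hf := (memLp_one_iff_integrable.1 (Lp.memLp f)).mono_measure h
  rwa [integrable_smul_measure (by simpa using hc.ne') ENNReal.coe_ne_top] at hf

variable [IsTopologicalGroup G] [LocallyCompactSpace G] [T2Space G] [BorelSpace G]
  [μ.IsHaarMeasure] [μ.Regular]

/-- Used twice: for the continuity of the augmentation, and to carry limits in `L¹(G, ω)` over to
`L¹(μ)`. -/
theorem BeurlingSpace.integral_norm_le (hc : 0 < c) (hω : ∀ x, c ≤ ω x)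
    (f : BeurlingSpace μ ω) : ∫ x, ‖f x‖ ∂μ ≤ (c : ℝ)⁻¹ * ‖f‖ := by
  rw [norm_eq, ← integral_const_mul]
  refine integral_mono (integrable hc hω f).norm ?_ fun x => ?_
  · refine ((ω.integrable_smul (Lp.memLp f)).norm.congr (ae_of_all _ fun x => ?_)).const_mul _
    simp [mul_comm]
  · have h1 : (0 : ℝ) < c := hc
    have h2 : (c : ℝ) ≤ ω x := hω x
    rw [inv_mul_eq_div, le_div_iff₀ h1]
    exact mul_le_mul_of_nonneg_left h2 (norm_nonneg _)

/-- The augmentation character `f ↦ ∫ f dμ` of `L¹(G, ω)`, for `ω` bounded away from `0`. -/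
def BeurlingSpace.augmentation (μ : Measure G) [μ.IsHaarMeasure] [μ.Regular] (ω : Weight G)
    (hc : 0 < c) (hω : ∀ x, c ≤ ω x) : BeurlingSpace μ ω →L[ℂ] ℂ :=
  LinearMap.mkContinuous
    { toFun := fun f => ∫ x, f x ∂μ
      map_add' := fun f g => by
        rw [← integral_add (integrable hc hω f) (integrable hc hω g)]
        exact integral_congr_ae ((ω.ae_iff (μ := μ) _).1 (Lp.coeFn_add f g))
      map_smul' := fun a f => by
        rw [RingHom.id_apply, ← integral_smul]
        exact integral_congr_ae ((ω.ae_iff (μ := μ) _).1 (Lp.coeFn_smul a f)) }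
    (c : ℝ)⁻¹ fun f => (norm_integral_le_integral_norm _).trans (integral_norm_le hc hω f)

theorem BeurlingSpace.augmentation_apply (hc : 0 < c) (hω : ∀ x, c ≤ ω x)
    (f : BeurlingSpace μ ω) :
    augmentation μ ω hc hω f = ∫ x, f x ∂μ := rfl

theorem BeurlingSpace.augmentation_translate (hc : 0 < c) (hω : ∀ x, c ≤ ω x)
    (y : G) (f : BeurlingSpace μ ω) :
    augmentation μ ω hc hω (translate ω y f) = augmentation μ ω hc hω f := by
  rw [augmentation_apply, augmentation_apply, ← integral_mul_left_eq_self (fun x => f x) y⁻¹]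
  exact integral_congr_ae ((ω.ae_iff (μ := μ) _).1 (translate_ae ω y f))

/-- The convolution is a vector-valued integral of the translates `δ_y * g` against `f y`. A
continuous functional passes inside it and takes the same value on every translate, so no Fubini
argument is needed. -/
theorem BeurlingSpace.augmentation_conv (hc : 0 < c) (hω : ∀ x, c ≤ ω x)
    (f g : BeurlingSpace μ ω) :
    augmentation μ ω hc hω (conv ω f g) =
      augmentation μ ω hc hω f * augmentation μ ω hc hω g := by
  rw [conv, ← ContinuousLinearMap.integral_comp_comm _ (conv_integrable ω f g)]
  simp only [map_smul, augmentation_translate, smul_eq_mul]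
  rw [integral_mul_const, ← augmentation_apply hc hω f]

/-- A nonnegative continuous bump at the identity has positive Haar integral. -/
theorem BeurlingSpace.augmentation_ne_zero (hc : 0 < c) (hω : ∀ x, c ≤ ω x) :
     augmentation μ ω hc hω ≠ 0 := by
  obtain ⟨k, hk, hk0⟩ := exists_continuous_nonneg_pos (1 : G)
  have hkc : Continuous fun x => (k x : ℂ) := Complex.continuous_ofReal.comp k.continuous
  have hks : HasCompactSupport fun x => (k x : ℂ) := hk.comp_left Complex.ofReal_zero
  have hpos : 0 < ∫ x, k x ∂μ :=
    k.continuous.integral_pos_of_hasCompactSupport_nonneg_nonzero hk hk0.1 hk0.2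
  intro h
  have h1 := DFunLike.congr_fun h ((memLp_cc (μ := μ) ω hkc hks).toLp _)
  rw [augmentation_apply, integral_congr_ae ((ω.ae_iff (μ := μ) _).1 (MemLp.coeFn_toLp _)),
    integral_complex_ofReal] at h1
  exact hpos.ne' (Complex.ofReal_eq_zero.1 h1)

/-- The `L¹(μ)`-distance of the absolute values of `δ_g * f` and `f` is controlled by the distance
of `δ_g * f` and `f` in `L¹(G, ω)`. -/
theorem BeurlingSpace.integral_abs_norm_translate_sub_le (hc : 0 < c) (hω : ∀ x, c ≤ ω x)
    (g : G) (f : BeurlingSpace μ ω) :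
    ∫ x, |‖f (g⁻¹ * x)‖ - ‖f x‖| ∂μ ≤ (c : ℝ)⁻¹ * ‖translate ω g f - f‖ := by
  refine le_trans (integral_mono_ae ?_ (integrable hc hω (translate ω g f - f)).norm ?_)
    (integral_norm_le hc hω _)
  · exact (((integrable hc hω f).norm.comp_mul_left g⁻¹).sub (integrable hc hω f).norm).abs
  · filter_upwards [(ω.ae_iff (μ := μ) _).1 (Lp.coeFn_sub (translate ω g f) f),
      (ω.ae_iff (μ := μ) _).1 (translate_ae ω g f)] with x h1 h2
    rw [h1, Pi.sub_apply, h2]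
    exact abs_norm_sub_norm_le _ _

/-- Take `a` with augmentation `1`; then `δ_g * a` also has augmentation `1`. Hence `(δ_g * a) * u
i` is asymptotic to `u i`, while the equal element `δ_g * (a * u i)` is asymptotic to `δ_g * u i`.
-/
theorem BeurlingSpace.tendsto_translate_sub (hc : 0 < c) (hω : ∀ x, c ≤ ω x) {ι : Type*}
    {l : Filter ι} {u : ι → BeurlingSpace μ ω}
    (hu : ∀ a, Tendsto (fun i => conv ω a (u i) - augmentation μ ω hc hω a • u i) l (𝓝 0))
    (g : G) : Tendsto (fun i => translate ω g (u i) - u i) l (𝓝 0) := by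
  obtain ⟨a, ha⟩ : ∃ a, augmentation μ ω hc hω a = 1 := by
    obtain ⟨a, ha⟩ : ∃ a, augmentation μ ω hc hω a ≠ 0 := by
      by_contra! h
      exact augmentation_ne_zero hc hω (ContinuousLinearMap.ext h)
    exact ⟨(augmentation μ ω hc hω a)⁻¹ • a, by rw [map_smul, smul_eq_mul, inv_mul_cancel₀ ha]⟩
  have h1 := ((translate ω g).continuous.tendsto 0).comp (hu a)
  have h2 := (hu (translate ω g a)).sub h1
  rw [map_zero, sub_zero] at h2
  refine h2.congr fun i => ?_
  rw [translate_conv, augmentation_translate, ha, one_smul, Function.comp_apply, one_smul, map_sub]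
  abel

/-- A net in `L¹(G, ω)` that is asymptotically invariant under convolution and on which the
augmentation tends to `1` yields a left-invariant mean. -/
theorem BeurlingSpace.isAmenableGroup_of_net (hc : 0 < c) (hω : ∀ x, c ≤ ω x) {ι : Type*}
    {l : Filter ι} [l.NeBot] {u : ι → BeurlingSpace μ ω}
    (hu : ∀ a, Tendsto (fun i => conv ω a (u i) - augmentation μ ω hc hω a • u i) l (𝓝 0))
    (hu1 : Tendsto (fun i => augmentation μ ω hc hω (u i)) l (𝓝 1)) : IsAmenableGroup μ := by
  -- Any `δ` in `(0, 1)` would do: the mass of `|u i|` dominates the modulus of the augmentation,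
  -- which tends to `1`.
  refine IsAmenableGroup.of_asymptotically_invariant μ (l := l) (δ := 1 / 2)
    (p := fun i x => ‖u i x‖) (fun i => (integrable hc hω (u i)).norm) (fun i x => norm_nonneg _)
    (by norm_num) ?_ fun g => ?_
  · have h1 : Tendsto (fun i => ‖augmentation μ ω hc hω (u i)‖) l (𝓝 1) := by simpa using hu1.norm
    filter_upwards [h1.eventually_const_le (show (1 / 2 : ℝ) < 1 by norm_num)] with i hi
    exact hi.trans (norm_integral_le_integral_norm _)
  · refine squeeze_zero (fun i => integral_nonneg fun x => abs_nonneg _)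
      (fun i => integral_abs_norm_translate_sub_le hc hω g (u i)) ?_
    simpa using (tendsto_translate_sub hc hω hu g).norm.const_mul (c : ℝ)⁻¹

end Character

end

theorem theorem3p2 {G : Type u} [Group G] [TopologicalSpace G] [IsTopologicalGroup G]
    [LocallyCompactSpace G] [T2Space G] [MeasurableSpace G] [BorelSpace G]
    (μ : Measure G) [μ.IsHaarMeasure] [μ.Regular] (ω : Weight G)
    (hω : ∃ c : ℝ≥0, 0 < c ∧ ∀ x, c ≤ ω x)
    (h : PseudoAmenable (BeurlingAlgebra μ ω)) :
    IsAmenableGroup μ := by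
  obtain ⟨c, hc, hω⟩ := hω
  -- `BeurlingAlgebra` unfolds to `BeurlingSpace` with product `conv`, so the facts about the
  -- augmentation apply by definitional equality.
  let φ : BeurlingAlgebra μ ω →L[ℂ] ℂ := BeurlingSpace.augmentation μ ω hc hω
  have hφ : ∀ a b, φ (a * b) = φ a * φ b := BeurlingSpace.augmentation_conv hc hω
  have hφ0 : φ ≠ 0 := BeurlingSpace.augmentation_ne_zero hc hω
  obtain ⟨ι, l, _, u, hu, hu1⟩ := h.exists_net_of_character hφ hφ0
  exact BeurlingSpace.isAmenableGroup_of_net hc hω hu hu1
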